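/- Let $N\in\mathbb N$. For every $n\ge 1$ let $w_{n1},\dots,w_{np_n}$, $p_n\ge 2$, be similarities of $\mathbb R^N$ with a common ratio $\lambda_n\in(0,1)$. Assume the regular open set condition: there is a nonempty bounded open set $V\subset\mathbb R^N$ such that, for every $n$, the sets $w_{nj}(V)$, $j=1,\dots,p_n$, are contained in $V$ and pairwise disjoint, $V$ and its closure $\overline V$ have the same Lebesgue measure, and $V$ is the interior of $\overline V$. Assume also $\sup_n p_n<\infty$. Put $P_n=\prod_{i=1}^n p_i$, $\Lambda_n=\prod_{i=1}^n\lambda_i$ and, for a multi-index $\sigma=(\sigma_1,\dots,\sigma_n)$ with $1\le\sigma_i\le p_i$, $w_\sigma=w_{1\sigma_1}\circ\dots\circ w_{n\sigma_n}$. Let $F=\bigcap_n\bigcup_{|\sigma|=n}w_\sigma(\overline V)$ be the associated translation fractal (equivalently, the limit in the Hausdorff distance of the decreasing sequence of compact sets $\bigcup_{|\sigma|=n}w_\sigma(\overline V)$). For a Borel probability measure $\mu_0$ on $\mathbb R^N$ let $\mu_n(A)=\sum_{|\sigma|=n}P_n^{-1}\mu_0(w_\sigma^{-1}(A))$. Then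 there is exactly one Borel probability measure $\mu$ (the canonical limit measure) such that, for every choice of $\mu_0$, $\mu_n\to\mu$ weakly, and the following hold. (i) For every $x\in F$, the tangential dimensions of $\mu$ at $x$ are $$\liminf_{\lambda\to0^+}\liminf_{r\to0^+}\frac{\log\bigl(\mu(B(x,r))/\mu(B(x,\lambda r))\bigr)}{\log 1/\lambda}=\liminf_{n,k\to\infty}\frac{\log P_{n+k}-\log P_n}{\log 1/\Lambda_{n+k}-\log 1/\Lambda_n},$$ $$\limsup_{\lambda\to0^+}\limsup_{r\to0^+}\frac{\log\bigl(\mu(B(x,r))/\mu(B(x,\lambda r))\bigr)}{\log 1/\lambda}=\limsup_{n,k\to\infty}\frac{\log P_{n+k}-\log P_n}{\log 1/\Lambda_{n+k}-\log 1/\Lambda_n}.$$ (ii) For every $x\in F$, the local dimensions of $\mu$ at $x$ are $$\liminf_{r\to0^+}\frac{\log\mu(B(x,r))}{\log r}=d_H(F)=\liminf_{n\to\infty}\frac{\log P_n}{\log 1/\Lambda_n},\qquad \limsup_{r\to0^+}\frac{\log\mu(B(x,r))}{\log r}=\limsup_{n\to\infty}\frac{\log P_n}{\log 1/\Lambda_n},$$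 where $d_H(F)$ is the Hausdorff dimension of $F$. Moreover, with $d=d_H(F)$ and $\mathcal H^d$ the $d$-dimensional Hausdorff measure, $0<\mathcal H^d(F)<\infty$ if and only if $\liminf_{n\to\infty}\bigl(\log P_n-d\log 1/\Lambda_n\bigr)$ is finite, that is, neither $-\infty$ nor $+\infty$. -/

import Mathlib

open MeasureTheory Filter Topology Set
open scoped ENNReal BoundedContinuousFunction

noncomputable section

/-- A sequence of finite families of contracting similarities of `ℝ^N`. The `n`-th family consists
of `p n ≥ 2` similarities, all with the same ratio `ratio n ∈ (0,1)`. Families are indexed from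
`0`. -/
structure SimilaritySequence (N : ℕ) where
  p : ℕ → ℕ
  ratio : ℕ → ℝ
  w : (n : ℕ) → Fin (p n) → EuclideanSpace ℝ (Fin N) → EuclideanSpace ℝ (Fin N)
  two_le_p : ∀ n, 2 ≤ p n
  ratio_pos : ∀ n, 0 < ratio n
  ratio_lt_one : ∀ n, ratio n < 1
  dist_w : ∀ n j x y, dist (w n j x) (w n j y) = ratio n * dist x y

namespace SimilaritySequence

variable {N : ℕ} (S : SimilaritySequence N)

/-- `Λ n`, the product of the first `n` ratios. -/
def Lam (n : ℕ) : ℝ := ∏ i ∈ Finset.range n, S.ratio i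

/-- `P n`, the product of the cardinalities of the first `n` families. -/
def P (n : ℕ) : ℕ := ∏ i ∈ Finset.range n, S.p i

/-- Multi-indices of length `n`. -/
abbrev Word (n : ℕ) : Type := (i : Fin n) → Fin (S.p i)

/-- The composition `w 0 (σ 0) ∘ w 1 (σ 1) ∘ ⋯ ∘ w (n-1) (σ (n-1))`. -/
def wordMap : (n : ℕ) → S.Word n → EuclideanSpace ℝ (Fin N) → EuclideanSpace ℝ (Fin N)
  | 0, _ => id
  | n + 1, σ => wordMap n (fun i => σ i.castSucc) ∘ S.w n (σ (Fin.last n))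

/-- The regular open set condition, with witness `V`. -/
structure RegularOpenSetCondition (V : Set (EuclideanSpace ℝ (Fin N))) : Prop where
  nonempty : V.Nonempty
  isBounded : Bornology.IsBounded V
  isOpen : IsOpen V
  image_subset : ∀ n j, S.w n j '' V ⊆ V
  disjoint : ∀ n, Pairwise fun i j => Disjoint (S.w n i '' V) (S.w n j '' V)
  volume_closure : volume V = volume (closure V)
  interior_closure : interior (closure V) = V

/-- The union of the sets `w_σ (closure V)` over all multi-indices of length `n`, that is
`W₁ ∘ ⋯ ∘ Wₙ` applied to the closure of `V`. -/
def stage (V : Set (EuclideanSpace ℝ (Fin N))) (n : ℕ) : Set (EuclideanSpace ℝ (Fin N)) :=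
  ⋃ σ : S.Word n, S.wordMap n σ '' closure V

/-- The translation fractal: the intersection of the decreasing sequence of compact sets
`stage V n`. It is their limit in the Hausdorff distance, see `tendsto_stage` below. -/
def fractal (V : Set (EuclideanSpace ℝ (Fin N))) : Set (EuclideanSpace ℝ (Fin N)) :=
  ⋂ n, S.stage V n

/-- The `n`-th approximation of the limit measure with starting measure `μ₀`:
`A ↦ ∑ P_n⁻¹ * μ₀ (w_σ⁻¹ A)`, the sum over all multi-indices `σ` of length `n`. -/
def approxMeasure (μ₀ : Measure (EuclideanSpace ℝ (Fin N))) (n : ℕ) :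
    Measure (EuclideanSpace ℝ (Fin N)) :=
  ∑ σ : S.Word n, (S.P n : ℝ≥0∞)⁻¹ • μ₀.map (S.wordMap n σ)

/-- `μ` is the canonical limit measure: the weak limit of the approximations, whatever the
starting Borel probability measure. -/
def IsLimitMeasure (μ : Measure (EuclideanSpace ℝ (Fin N))) : Prop :=
  IsProbabilityMeasure μ ∧
    ∀ μ₀ : Measure (EuclideanSpace ℝ (Fin N)), IsProbabilityMeasure μ₀ →
      ∀ f : EuclideanSpace ℝ (Fin N) →ᵇ ℝ,
        Tendsto (fun n => ∫ x, f x ∂(S.approxMeasure μ₀ n)) atTop (𝓝 (∫ x, f x ∂μ))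

theorem continuous_w (n : ℕ) (j : Fin (S.p n)) : Continuous (S.w n j) :=
  (LipschitzWith.of_dist_le_mul (K := ⟨S.ratio n, (S.ratio_pos n).le⟩)
    fun x y => (S.dist_w n j x y).le).continuous

theorem continuous_wordMap : ∀ (n : ℕ) (σ : S.Word n), Continuous (S.wordMap n σ)
  | 0, _ => continuous_id
  | n + 1, _ => (continuous_wordMap n _).comp (S.continuous_w n _)

variable {S} {V : Set (EuclideanSpace ℝ (Fin N))}

theorem isCompact_stage (hV : S.RegularOpenSetCondition V) (n : ℕ) : IsCompact (S.stage V n) :=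
  isCompact_iUnion fun σ => hV.isBounded.isCompact_closure.image (S.continuous_wordMap n σ)

theorem nonempty_stage (hV : S.RegularOpenSetCondition V) (n : ℕ) : (S.stage V n).Nonempty := by
  obtain ⟨v, hv⟩ := hV.nonempty
  exact ⟨_, mem_iUnion.2 ⟨fun i => ⟨0, by have := S.two_le_p i; omega⟩,
    mem_image_of_mem _ (subset_closure hv)⟩⟩

theorem stage_succ_subset (hV : S.RegularOpenSetCondition V) (n : ℕ) :
    S.stage V (n + 1) ⊆ S.stage V n := by
  intro x hx
  obtain ⟨σ, y, hy, rfl⟩ := mem_iUnion.1 hx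
  refine mem_iUnion.2 ⟨fun i => σ i.castSucc, S.w n (σ (Fin.last n)) y, ?_, rfl⟩
  exact closure_mono (hV.image_subset n _)
    (image_closure_subset_closure_image (S.continuous_w n _) (mem_image_of_mem _ hy))

/-- The translation fractal is the limit of the stages in the Hausdorff distance. -/
theorem tendsto_stage (hV : S.RegularOpenSetCondition V) :
    Tendsto (fun n => Metric.hausdorffEDist (S.stage V n) (S.fractal V)) atTop (𝓝 0) := by
  have hanti : Antitone (S.stage V) := antitone_nat_of_succ_le (stage_succ_subset hV)
  rw [ENNReal.tendsto_nhds_zero]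
  intro ε hε
  obtain ⟨n, hn⟩ := exists_subset_nhds_of_isCompact (hanti.directed_ge)
    (isCompact_stage hV) (U := {x | Metric.infEDist x (S.fractal V) < ε}) (fun x hx =>
      (isOpen_lt Metric.continuous_infEDist continuous_const).mem_nhds (by
        simpa [Metric.infEDist_zero_of_mem (s := S.fractal V) hx] using hε))
  filter_upwards [eventually_ge_atTop n] with m hm
  refine Metric.hausdorffEDist_le_of_infEDist (fun x hx => (hn (hanti hm hx)).le) fun x hx => ?_
  rw [Metric.infEDist_zero_of_mem (mem_iInter.1 hx m)]
  exact zero_le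

end SimilaritySequence

section Dimensions

variable {X : Type*} [MetricSpace X] [MeasurableSpace X]

/-- Lower local dimension of `μ` at `x`. -/
def lowerLocalDim (μ : Measure X) (x : X) : EReal :=
  liminf (fun r : ℝ => ENNReal.log (μ (Metric.ball x r)) / (Real.log r : EReal)) (𝓝[>] 0)

/-- Upper local dimension of `μ` at `x`. -/
def upperLocalDim (μ : Measure X) (x : X) : EReal :=
  limsup (fun r : ℝ => ENNReal.log (μ (Metric.ball x r)) / (Real.log r : EReal)) (𝓝[>] 0)

/-- Lower tangential dimension of `μ` at a point `x` of its support. -/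
def lowerTangentialDim (μ : Measure X) (x : X) : EReal :=
  liminf (fun l : ℝ => liminf (fun r : ℝ =>
    ENNReal.log (μ (Metric.ball x r) / μ (Metric.ball x (l * r))) / (Real.log (1 / l) : EReal))
      (𝓝[>] 0)) (𝓝[>] 0)

/-- Upper tangential dimension of `μ` at a point `x` of its support. -/
def upperTangentialDim (μ : Measure X) (x : X) : EReal :=
  limsup (fun l : ℝ => limsup (fun r : ℝ =>
    ENNReal.log (μ (Metric.ball x r) / μ (Metric.ball x (l * r))) / (Real.log (1 / l) : EReal))
      (𝓝[>] 0)) (𝓝[>] 0)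

end Dimensions

end

/-! ### Averaged growth of a function that tracks a sequence along scales -/

/-! The limit measure is the law of the point with a random infinite multi-index, all letters being
independent and uniform, so the cells of generation `n` carry mass about `1 / P n`. Volume
comparison shows that a ball of radius at most `Λ n` meets boundedly many of these cells, hence has
mass at most `C / P n` (`exists_measure_ball_le`). A ball of radius `R * Λ n` centred on the fractal
contains a whole cell, hence has mass at least `1 / P n` (`exists_le_measure_ball`).

In the coordinate `t = -log r`, put `G t = -log μ(B(x, exp (-t)))`. As the `p n` are bounded, the
two estimates say that `G` stays within a constant of `log P n` for `t` between `log 1/Λ n` and `log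
1/Λ (n+1)` (`exists_tracksAlong`). Local dimensions are limits of `G t / t` and tangential
dimensions are limits of increments of `G` over long windows. Bounded errors disappear in both, so
the formulas become statements about real functions (`TracksAlong`).

For Hausdorff measures, covering by cells bounds `H^d(F)` above by a multiple of `P n * Λ n ^ d` for
infinitely many `n`, and the mass distribution principle gives the matching lower bound. Both the
dimension formula and the finiteness criterion follow. -/

theorem EReal.le_of_forall_real_sub_le {x y : EReal}
    (h : ∀ c : ℝ, (c : EReal) < x → ∀ ε : ℝ, 0 < ε → ((c - ε : ℝ) : EReal) ≤ y) : x ≤ y := by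
  refine le_of_forall_lt fun z hz => ?_
  obtain ⟨c, hzc, hcx⟩ := EReal.lt_iff_exists_real_btwn.1 hz
  obtain ⟨e, hze, hec⟩ := EReal.lt_iff_exists_real_btwn.1 hzc
  refine hze.trans_le ?_
  have := h c hcx (c - e) (_root_.sub_pos.2 (EReal.coe_lt_coe_iff.1 hec))
  rwa [sub_sub_cancel] at this

theorem EReal.le_of_forall_le_real_add {x y : EReal}
    (h : ∀ c : ℝ, y < (c : EReal) → ∀ ε : ℝ, 0 < ε → x ≤ ((c + ε : ℝ) : EReal)) : x ≤ y := by
  refine le_of_forall_gt fun z hz => ?_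
  obtain ⟨c, hyc, hcz⟩ := EReal.lt_iff_exists_real_btwn.1 hz
  obtain ⟨e, hce, hez⟩ := EReal.lt_iff_exists_real_btwn.1 hcz
  refine lt_of_le_of_lt ?_ hez
  have := h c hyc (e - c) (_root_.sub_pos.2 (EReal.coe_lt_coe_iff.1 hce))
  rwa [add_sub_cancel] at this

/-- Absorbs a bounded error `B` into the loss `ε` that `EReal.le_of_forall_real_sub_le` and
`EReal.le_of_forall_le_real_add` allow. -/
theorem eventually_const_le_mul {α : Type*} {F : Filter α} {u : α → ℝ} (hu : Tendsto u F atTop)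
    (B : ℝ) {ε : ℝ} (hε : 0 < ε) : ∀ᶠ x in F, 0 < u x ∧ B ≤ ε * u x := by
  filter_upwards [hu.eventually_gt_atTop 0, hu.eventually_ge_atTop (B / ε)] with x h1 h2
  exact ⟨h1, by rwa [div_le_iff₀' hε] at h2⟩

/-- A function `G` on the real line tracks the sequence `a` along the scales `L`: up to the error
`K`, it equals `a n` between `L n` and `L (n + 1)`. -/
structure TracksAlong (a L : ℕ → ℝ) (A c : ℝ) (G : ℝ → ℝ) (K : ℝ) : Prop where
  gap_pos : 0 < c
  scale_zero : L 0 = 0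
  scale_step : ∀ n, L n + c ≤ L (n + 1)
  zero : a 0 = 0
  mono : Monotone a
  step : ∀ n, a (n + 1) ≤ a n + A
  monotone : Monotone G
  abs_sub_le : ∀ n t, L n ≤ t → t ≤ L (n + 1) → |G t - a n| ≤ K

/-! ### Elementary consequences of tracking -/

namespace TracksAlong

variable {a L : ℕ → ℝ} {A c K : ℝ} {G : ℝ → ℝ}

theorem scale_add (h : TracksAlong a L A c G K) (n k : ℕ) : L n + k * c ≤ L (n + k) := by
  induction k with
  | zero => simp
  | succ k ih =>
    have := h.scale_step (n + k)
    rw [← add_assoc]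
    push_cast
    linarith

theorem strictMono_scale (h : TracksAlong a L A c G K) : StrictMono L :=
  strictMono_nat_of_lt_succ fun n => by linarith [h.scale_step n, h.gap_pos]

theorem tendsto_scale (h : TracksAlong a L A c G K) : Tendsto L atTop atTop := by
  refine tendsto_atTop_mono (fun n => ?_) (tendsto_natCast_atTop_atTop.atTop_mul_const h.gap_pos)
  simpa [h.scale_zero] using h.scale_add 0 n

theorem tendsto_scale_sub (h : TracksAlong a L A c G K) :
    Tendsto (fun q : ℕ × ℕ => L (q.1 + q.2) - L q.1) (atTop ×ˢ atTop) atTop := by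
  refine tendsto_atTop_mono (fun q => ?_)
    ((tendsto_natCast_atTop_atTop.atTop_mul_const h.gap_pos).comp tendsto_snd)
  have := h.scale_add q.1 q.2
  simp only [Function.comp_apply]
  linarith

theorem add_le (h : TracksAlong a L A c G K) (n k : ℕ) : a (n + k) ≤ a n + k * A := by
  induction k with
  | zero => simp
  | succ k ih =>
    have := h.step (n + k)
    rw [← add_assoc]
    push_cast
    linarith

theorem nonneg (h : TracksAlong a L A c G K) (n : ℕ) : 0 ≤ a n :=
  h.zero ▸ h.mono (Nat.zero_le n)

theorem step_nonneg (h : TracksAlong a L A c G K) : 0 ≤ A := by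
  linarith [h.step 0, h.mono (Nat.zero_le 1)]

theorem exists_mem (h : TracksAlong a L A c G K) {t : ℝ} (ht : 0 ≤ t) :
    ∃ n, L n ≤ t ∧ t < L (n + 1) := by
  classical
  have hex : ∃ n, t < L n := (h.tendsto_scale.eventually_gt_atTop t).exists
  have h0 : Nat.find hex ≠ 0 := fun h0 => by
    have := Nat.find_spec hex
    rw [h0, h.scale_zero] at this
    linarith
  obtain ⟨n, hn⟩ := Nat.exists_eq_succ_of_ne_zero h0
  exact ⟨n, not_lt.1 (Nat.find_min hex (by omega)), by
    have := Nat.find_spec hex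
    rwa [hn] at this⟩

theorem exists_mem_ge (h : TracksAlong a L A c G K) (n₀ : ℕ) :
    ∀ᶠ t in atTop, ∃ n ≥ n₀, L n ≤ t ∧ t < L (n + 1) := by
  filter_upwards [eventually_ge_atTop 0, eventually_ge_atTop (L n₀)] with t h0 ht
  obtain ⟨n, h1, h2⟩ := h.exists_mem h0
  refine ⟨n, ?_, h1, h2⟩
  have := h.strictMono_scale.lt_iff_lt.1 (ht.trans_lt h2)
  omega

theorem abs_scale (h : TracksAlong a L A c G K) (n : ℕ) : |G (L n) - a n| ≤ K :=
  h.abs_sub_le n _ le_rfl (h.strictMono_scale (Nat.lt_succ_self n)).le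

/-! #### Logarithmic growth from the origin -/

/-- Sampling at `t = L n` gives one inequality. For the other, `G` is almost constant on `[L n, L (n
+ 1)]`, so the quotient is smallest near the right end, where it is compared with `a (n + 1) / L (n
+ 1)` at the cost of one step `A`. -/
theorem liminf_div (h : TracksAlong a L A c G K) :
    liminf (fun t : ℝ => ((G t / t : ℝ) : EReal)) atTop =
      liminf (fun n => ((a n / L n : ℝ) : EReal)) atTop := by
  apply le_antisymm
  · refine EReal.le_of_forall_real_sub_le fun b hb ε hε => le_liminf_of_le (by isBoundedDefault) ?_
    filter_upwards [h.tendsto_scale.eventually (eventually_lt_of_lt_liminf hb),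
      eventually_const_le_mul h.tendsto_scale K hε] with n hn ⟨hL, hK⟩
    rw [EReal.coe_lt_coe_iff, lt_div_iff₀ hL] at hn
    rw [EReal.coe_le_coe_iff, le_div_iff₀ hL]
    linarith [abs_le.1 (h.abs_scale n)]
  · refine EReal.le_of_forall_real_sub_le fun b hb ε hε => le_liminf_of_le (by isBoundedDefault) ?_
    have ev := (eventually_lt_of_lt_liminf hb).and (h.tendsto_scale.eventually_gt_atTop 0)
    obtain ⟨n₀, hn₀⟩ := eventually_atTop.1 ev
    filter_upwards [h.exists_mem_ge n₀, eventually_const_le_mul tendsto_id (A + K) hε]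
      with t ⟨n, hn, h1, h2⟩ ⟨ht, hK⟩
    obtain ⟨hn1, hL⟩ := hn₀ (n + 1) (by omega)
    rw [EReal.coe_lt_coe_iff, lt_div_iff₀ hL] at hn1
    rw [id] at hK ht
    rw [EReal.coe_le_coe_iff, le_div_iff₀ ht]
    have h3 := abs_le.1 (h.abs_sub_le n t h1 h2.le)
    have h4 := h.step n
    rcases le_total 0 b with hb0 | hb0
    · nlinarith [mul_le_mul_of_nonneg_left h2.le hb0]
    · nlinarith [h.nonneg n, h.step_nonneg, mul_nonneg (neg_nonneg.2 hb0) ht.le]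

/-- Here the extreme case on `[L n, L (n + 1)]` is the left end, so no step of `a` is lost. -/
theorem limsup_div (h : TracksAlong a L A c G K) :
    limsup (fun t : ℝ => ((G t / t : ℝ) : EReal)) atTop =
      limsup (fun n => ((a n / L n : ℝ) : EReal)) atTop := by
  apply le_antisymm
  · refine EReal.le_of_forall_le_real_add fun b hb ε hε => limsup_le_of_le (by isBoundedDefault) ?_
    have ev := (eventually_lt_of_limsup_lt hb).and (h.tendsto_scale.eventually_gt_atTop 0)
    obtain ⟨n₀, hn₀⟩ := eventually_atTop.1 ev
    filter_upwards [h.exists_mem_ge n₀, eventually_const_le_mul tendsto_id K hε]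
      with t ⟨n, hn, h1, h2⟩ ⟨ht, hK⟩
    obtain ⟨hn1, hL⟩ := hn₀ n hn
    have hb0 : 0 ≤ b := (div_nonneg (h.nonneg n) hL.le).trans (EReal.coe_lt_coe_iff.1 hn1).le
    rw [EReal.coe_lt_coe_iff, div_lt_iff₀ hL] at hn1
    rw [id] at hK ht
    rw [EReal.coe_le_coe_iff, div_le_iff₀ ht]
    have h3 := abs_le.1 (h.abs_sub_le n t h1 h2.le)
    nlinarith [mul_le_mul_of_nonneg_left h1 hb0]
  · refine EReal.le_of_forall_le_real_add fun b hb ε hε => limsup_le_of_le (by isBoundedDefault) ?_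
    filter_upwards [h.tendsto_scale.eventually (eventually_lt_of_limsup_lt hb),
      eventually_const_le_mul h.tendsto_scale K hε] with n hn ⟨hL, hK⟩
    rw [EReal.coe_lt_coe_iff, div_lt_iff₀ hL] at hn
    rw [EReal.coe_le_coe_iff, div_le_iff₀ hL]
    linarith [abs_le.1 (h.abs_scale n)]

/-! #### Growth over long windows -/

theorem mul_le_sub_of_window {G : ℝ → ℝ} {t₀ h b : ℝ} (hh : 0 < h)
    (hG : ∀ t ≥ t₀, b * h ≤ G (t + h) - G t) {t : ℝ} (ht : t₀ ≤ t) (m : ℕ) :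
    b * (m * h) ≤ G (t + m * h) - G t := by
  induction m with
  | zero => simp
  | succ m ih =>
    have := hG (t + m * h) (by have : 0 ≤ m * h := by positivity
                               linarith)
    rw [show t + ((m + 1 : ℕ) : ℝ) * h = t + m * h + h by push_cast; ring]
    push_cast
    nlinarith

/-- For `≤`, one good window length `s` tiles `[L n, L (n + k)]` up to a remainder shorter than `s`.
For `≥`, a window `[t, t + s]` is enlarged to an interval between scales; the lengths of the gaps do
not matter, since the increment of `a` over each gap is at most `A`. -/
theorem liminf_window (h : TracksAlong a L A c G K) :
    liminf (fun s : ℝ => liminf (fun t : ℝ => (((G (t + s) - G t) / s : ℝ) : EReal)) atTop) atTop =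
      liminf (fun q : ℕ × ℕ => (((a (q.1 + q.2) - a q.1) / (L (q.1 + q.2) - L q.1) : ℝ) : EReal))
        (atTop ×ˢ atTop) := by
  apply le_antisymm
  · refine EReal.le_of_forall_real_sub_le fun b hb ε hε => le_liminf_of_le (by isBoundedDefault) ?_
    obtain ⟨s, hs, hs0⟩ := ((eventually_lt_of_lt_liminf hb).and (eventually_gt_atTop 0)).exists
    obtain ⟨t₀, ht₀⟩ := eventually_atTop.1 (eventually_lt_of_lt_liminf hs)
    have hG : ∀ t ≥ t₀, b * s ≤ G (t + s) - G t := fun t ht => by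
      have := ht₀ t ht
      rw [EReal.coe_lt_coe_iff, lt_div_iff₀ hs0] at this
      exact this.le
    filter_upwards [eventually_const_le_mul h.tendsto_scale_sub (|b| * s + 2 * K) hε,
      tendsto_fst.eventually (h.tendsto_scale.eventually_ge_atTop t₀)] with q ⟨hD, hK⟩ hq
    rw [EReal.coe_le_coe_iff, le_div_iff₀ hD]
    set D := L (q.1 + q.2) - L q.1 with hDdef
    have hm := Nat.floor_le (div_nonneg hD.le hs0.le)
    have hm' := Nat.lt_floor_add_one (D / s)
    set m := ⌊D / s⌋₊
    rw [le_div_iff₀ hs0] at hm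
    rw [div_lt_iff₀ hs0] at hm'
    have h1 := mul_le_sub_of_window hs0 hG hq m
    have h2 := h.monotone (show L q.1 + m * s ≤ L (q.1 + q.2) by linarith)
    have h3 := abs_le.1 (h.abs_scale q.1)
    have h4 := abs_le.1 (h.abs_scale (q.1 + q.2))
    have h5 : b * (D - m * s) ≤ |b| * s :=
      mul_le_mul (le_abs_self b) (by linarith) (by linarith) (abs_nonneg b)
    nlinarith
  · refine EReal.le_of_forall_real_sub_le fun b hb ε hε => le_liminf_of_le (by isBoundedDefault) ?_
    have ev := (eventually_lt_of_lt_liminf hb).and (h.tendsto_scale_sub.eventually_gt_atTop 0)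
    rw [prod_atTop_atTop_eq] at ev
    obtain ⟨⟨n₀, k₀⟩, hnk⟩ := eventually_atTop.1 ev
    filter_upwards [eventually_const_le_mul tendsto_id (A * (1 + k₀) + 2 * K) hε] with s ⟨hs, hK⟩
    rw [id] at hK hs
    refine le_liminf_of_le (by isBoundedDefault) ?_
    filter_upwards [h.exists_mem_ge n₀, eventually_ge_atTop 0] with t ⟨n, hn, h1, h2⟩ ht
    rw [EReal.coe_le_coe_iff, le_div_iff₀ hs]
    obtain ⟨m, h3, h4⟩ := h.exists_mem (add_nonneg ht hs.le)
    have hnm : n ≤ m := by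
      have := h.strictMono_scale.lt_iff_lt.1 (show L n < L (m + 1) by linarith)
      omega
    obtain ⟨k, rfl⟩ := Nat.exists_eq_add_of_le hnm
    -- The `1` makes the interval cover `t + s`; the `k₀` makes it long enough for the hypothesis,
    -- whatever `k` is. The overshoot costs `A * (1 + k₀)`.
    obtain ⟨h5, h6⟩ := hnk (n, k + 1 + k₀) ⟨hn, by simp⟩
    simp only at h5 h6
    rw [EReal.coe_lt_coe_iff, lt_div_iff₀ h6] at h5
    have h7 := h.strictMono_scale.monotone (show n + k + 1 ≤ n + (k + 1 + k₀) by omega)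
    have h8 := h.add_le (n + k) (1 + k₀)
    rw [show n + k + (1 + k₀) = n + (k + 1 + k₀) by ring] at h8
    push_cast at h8
    have h9 := abs_le.1 (h.abs_sub_le n t h1 h2.le)
    have h10 := abs_le.1 (h.abs_sub_le (n + k) (t + s) h3 h4.le)
    rcases le_total 0 b with hb0 | hb0
    · nlinarith [mul_le_mul_of_nonneg_left (show s ≤ L (n + (k + 1 + k₀)) - L n by linarith) hb0]
    · nlinarith [h.monotone (show t ≤ t + s by linarith), mul_nonneg (neg_nonneg.2 hb0) hs.le,
        mul_pos hε hs]

/-- An upper bound cannot be transferred from an enlarged interval, as the gaps of `L` may be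
arbitrarily long. The window is shrunk to `[L (n + 1), L (n + k)]` instead. The reverse inequality
tiles with one window too many. -/
theorem limsup_window (h : TracksAlong a L A c G K) :
    limsup (fun s : ℝ => limsup (fun t : ℝ => (((G (t + s) - G t) / s : ℝ) : EReal)) atTop) atTop =
      limsup (fun q : ℕ × ℕ => (((a (q.1 + q.2) - a q.1) / (L (q.1 + q.2) - L q.1) : ℝ) : EReal))
        (atTop ×ˢ atTop) := by
  apply le_antisymm
  · refine EReal.le_of_forall_le_real_add fun b hb ε hε => limsup_le_of_le (by isBoundedDefault) ?_
    have ev := (eventually_lt_of_limsup_lt hb).and (h.tendsto_scale_sub.eventually_gt_atTop 0)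
    rw [prod_atTop_atTop_eq] at ev
    obtain ⟨⟨n₀, k₀⟩, hnk⟩ := eventually_atTop.1 ev
    filter_upwards [eventually_const_le_mul tendsto_id (A * (1 + k₀) + 2 * K) hε] with s ⟨hs, hK⟩
    rw [id] at hK hs
    refine limsup_le_of_le (by isBoundedDefault) ?_
    filter_upwards [h.exists_mem_ge n₀, eventually_ge_atTop 0] with t ⟨n, hn, h1, h2⟩ ht
    rw [EReal.coe_le_coe_iff, div_le_iff₀ hs]
    obtain ⟨m, h3, h4⟩ := h.exists_mem (add_nonneg ht hs.le)
    have hnm : n ≤ m := by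
      have := h.strictMono_scale.lt_iff_lt.1 (show L n < L (m + 1) by linarith)
      omega
    obtain ⟨k, rfl⟩ := Nat.exists_eq_add_of_le hnm
    have h9 := abs_le.1 (h.abs_sub_le n t h1 h2.le)
    have h10 := abs_le.1 (h.abs_sub_le (n + k) (t + s) h3 h4.le)
    have hA := h.step_nonneg
    have hb0 : 0 ≤ b := by
      obtain ⟨h5, h6⟩ := hnk (n, k₀) ⟨hn, le_rfl⟩
      refine le_trans ?_ (EReal.coe_lt_coe_iff.1 h5).le
      exact div_nonneg (sub_nonneg.2 (h.mono (Nat.le_add_right _ _))) h6.le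
    -- When few scales fit in the window, `a` grows by at most `(1 + k₀) * A`, already a bounded
    -- error; otherwise the shrunk interval still spans at least `k₀` indices.
    rcases le_or_gt k (k₀ + 1) with hk | hk
    · have h8 := h.add_le n k
      have hk' : (k : ℝ) ≤ 1 + k₀ := by
        have : (k : ℝ) ≤ ((k₀ + 1 : ℕ) : ℝ) := Nat.cast_le.2 hk
        push_cast at this
        linarith
      nlinarith [mul_le_mul_of_nonneg_right hk' hA, mul_nonneg hb0 hs.le]
    · obtain ⟨j, rfl⟩ : ∃ j, k = 1 + j := ⟨k - 1, by omega⟩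
      obtain ⟨h5, h6⟩ := hnk (n + 1, j) ⟨by simp only; omega, by simp only; omega⟩
      simp only at h5 h6
      rw [EReal.coe_lt_coe_iff, div_lt_iff₀ h6] at h5
      rw [← add_assoc] at h3 h10
      have h8 := h.step n
      have h11 := mul_le_mul_of_nonneg_left (show L (n + 1 + j) - L (n + 1) ≤ s by linarith) hb0
      have h12 : 0 ≤ A * (k₀ : ℝ) := by positivity
      nlinarith
  · refine EReal.le_of_forall_le_real_add fun b hb ε hε => limsup_le_of_le (by isBoundedDefault) ?_
    obtain ⟨s, hs, hs0⟩ := ((eventually_lt_of_limsup_lt hb).and (eventually_gt_atTop 0)).exists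
    obtain ⟨t₀, ht₀⟩ := eventually_atTop.1 (eventually_lt_of_limsup_lt hs)
    -- The sign change lets `mul_le_sub_of_window` iterate an upper bound.
    have hG : ∀ t ≥ t₀, (-b) * s ≤ (-G) (t + s) - (-G) t := fun t ht => by
      have := ht₀ t ht
      rw [EReal.coe_lt_coe_iff, div_lt_iff₀ hs0] at this
      simp only [Pi.neg_apply]
      linarith
    filter_upwards [eventually_const_le_mul h.tendsto_scale_sub (|b| * s + 2 * K) hε,
      tendsto_fst.eventually (h.tendsto_scale.eventually_ge_atTop t₀)] with q ⟨hD, hK⟩ hq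
    rw [EReal.coe_le_coe_iff, div_le_iff₀ hD]
    set D := L (q.1 + q.2) - L q.1 with hDdef
    have hm := Nat.floor_le (div_nonneg hD.le hs0.le)
    have hm' := Nat.lt_floor_add_one (D / s)
    set m := ⌊D / s⌋₊
    rw [le_div_iff₀ hs0] at hm
    rw [div_lt_iff₀ hs0] at hm'
    have h1 := mul_le_sub_of_window hs0 hG hq (m + 1)
    push_cast at h1
    simp only [Pi.neg_apply] at h1
    have h2 := h.monotone (show L (q.1 + q.2) ≤ L q.1 + (m + 1) * s by linarith)
    have h3 := abs_le.1 (h.abs_scale q.1)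
    have h4 := abs_le.1 (h.abs_scale (q.1 + q.2))
    have h5 : b * ((m + 1) * s - D) ≤ |b| * s :=
      mul_le_mul (le_abs_self b) (by linarith) (by linarith) (abs_nonneg b)
    nlinarith

end TracksAlong

noncomputable section

namespace SimilaritySequence

variable {N : ℕ} (S : SimilaritySequence N)

/-! ### Words, cylinders and their sizes -/

instance neZero_p (n : ℕ) : NeZero (S.p n) := ⟨by have := S.two_le_p n; omega⟩

theorem Lam_succ (n : ℕ) : S.Lam (n + 1) = S.Lam n * S.ratio n := Finset.prod_range_succ _ _

theorem P_succ (n : ℕ) : S.P (n + 1) = S.P n * S.p n := Finset.prod_range_succ _ _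

theorem Lam_pos (n : ℕ) : 0 < S.Lam n := Finset.prod_pos fun i _ => S.ratio_pos i

theorem P_pos (n : ℕ) : 0 < S.P n := Finset.prod_pos fun i _ => by have := S.two_le_p i; omega

theorem card_word (n : ℕ) : Fintype.card (S.Word n) = S.P n := by
  simp [Fintype.card_pi, P, Finset.prod_range]

theorem dist_wordMap : ∀ (n : ℕ) (σ : S.Word n) (x y : EuclideanSpace ℝ (Fin N)),
    dist (S.wordMap n σ x) (S.wordMap n σ y) = S.Lam n * dist x y
  | 0, _, x, y => by simp [wordMap, Lam]
  | n + 1, σ, x, y => by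
    simp only [wordMap, Function.comp_apply]
    rw [dist_wordMap n, S.dist_w, S.Lam_succ, mul_assoc]

theorem injective_wordMap (n : ℕ) (σ : S.Word n) : Function.Injective (S.wordMap n σ) :=
  fun x y hxy => by
    have := S.dist_wordMap n σ x y
    rw [hxy, dist_self, zero_eq_mul] at this
    exact dist_eq_zero.1 (this.resolve_left (S.Lam_pos n).ne')

/-- The initial segment of length `n` of an infinite multi-index. -/
def trunc (n : ℕ) (ω : (i : ℕ) → Fin (S.p i)) : S.Word n := fun i => ω i

theorem wordMap_trunc_succ (n : ℕ) (ω : (i : ℕ) → Fin (S.p i)) (x : EuclideanSpace ℝ (Fin N)) :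
    S.wordMap (n + 1) (S.trunc (n + 1) ω) x = S.wordMap n (S.trunc n ω) (S.w n (ω n) x) := rfl

theorem measurable_trunc (n : ℕ) : Measurable (S.trunc n) :=
  measurable_pi_lambda _ fun i => measurable_pi_apply (i : ℕ)

/-- The product of the uniform probability measures on the alphabets. -/
def codeMeasure : Measure ((i : ℕ) → Fin (S.p i)) :=
  Measure.infinitePi fun _ => ProbabilityTheory.uniformOn univ

instance isProbabilityMeasure_uniformOn (i : ℕ) :
    IsProbabilityMeasure (ProbabilityTheory.uniformOn (univ : Set (Fin (S.p i)))) :=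
  ProbabilityTheory.isProbabilityMeasure_uniformOn finite_univ univ_nonempty

instance isProbabilityMeasure_codeMeasure : IsProbabilityMeasure S.codeMeasure := by
  unfold codeMeasure
  infer_instance

theorem codeMeasure_trunc_preimage (n : ℕ) (σ : S.Word n) :
    S.codeMeasure (S.trunc n ⁻¹' {σ}) = (S.P n : ℝ≥0∞)⁻¹ := by
  -- The condition quantifies over `i < n` so that the factor is defined for every `i`, as
  -- `Measure.infinitePi_pi` demands.
  have heq : S.trunc n ⁻¹' {σ} = Set.pi (Finset.range n : Set ℕ)
      (fun i => {j : Fin (S.p i) | ∀ h : i < n, j = σ ⟨i, h⟩}) := by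
    ext ω
    simp only [mem_preimage, mem_singleton_iff, funext_iff, Set.mem_pi, mem_ofPred_eq, trunc,
      Finset.coe_range, mem_Iio]
    exact ⟨fun h i _ hi => h ⟨i, hi⟩, fun h i => h i i.2 i.2⟩
  rw [heq, codeMeasure, Measure.infinitePi_pi _ fun i _ => MeasurableSet.of_discrete, P,
    Nat.cast_prod, ENNReal.prod_inv_distrib]
  · refine Finset.prod_congr rfl fun i hi => ?_
    have : {j : Fin (S.p i) | ∀ h : i < n, j = σ ⟨i, h⟩} = {σ ⟨i, Finset.mem_range.1 hi⟩} := by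
      ext j
      simp [Finset.mem_range.1 hi]
    rw [this, ProbabilityTheory.uniformOn_univ]
    simp
  · intro i _ j _ _
    exact Or.inl (by simpa using NeZero.ne (S.p i))

theorem codeMeasure_trunc_preimage_finset (n : ℕ) (T : Finset (S.Word n)) :
    S.codeMeasure (S.trunc n ⁻¹' (T : Set (S.Word n))) ≤ T.card * (S.P n : ℝ≥0∞)⁻¹ := by
  have : S.trunc n ⁻¹' (T : Set (S.Word n)) = ⋃ σ ∈ T, S.trunc n ⁻¹' {σ} := by
    ext ω
    simp
  rw [this]
  refine (measure_biUnion_finset_le _ _).trans ?_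
  simp [codeMeasure_trunc_preimage]

/-- Realizes all approximations as laws of random points on one probability space, where weak
convergence can come from pointwise convergence. -/
theorem approxMeasure_eq_map (μ₀ : Measure (EuclideanSpace ℝ (Fin N))) [IsProbabilityMeasure μ₀]
    (n : ℕ) : S.approxMeasure μ₀ n =
      (S.codeMeasure.prod μ₀).map (fun q => S.wordMap n (S.trunc n q.1) q.2) ∧
      Measurable (fun q : ((i : ℕ) → Fin (S.p i)) × EuclideanSpace ℝ (Fin N) =>
        S.wordMap n (S.trunc n q.1) q.2) := by
  have hm : Measurable (fun q : ((i : ℕ) → Fin (S.p i)) × EuclideanSpace ℝ (Fin N) =>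
      S.wordMap n (S.trunc n q.1) q.2) :=
    (measurable_from_prod_countable_right (f := fun q : S.Word n × EuclideanSpace ℝ (Fin N) =>
      S.wordMap n q.1 q.2) fun σ => (S.continuous_wordMap n σ).measurable).comp
      ((S.measurable_trunc n).prodMap measurable_id)
  refine ⟨?_, hm⟩
  ext A hA
  rw [Measure.map_apply hm hA]
  have heq : (fun q : ((i : ℕ) → Fin (S.p i)) × EuclideanSpace ℝ (Fin N) =>
      S.wordMap n (S.trunc n q.1) q.2) ⁻¹' A =
      ⋃ σ : S.Word n, (S.trunc n ⁻¹' {σ}) ×ˢ (S.wordMap n σ ⁻¹' A) := by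
    ext q
    simp
  rw [heq, measure_iUnion, tsum_fintype]
  · simp only [approxMeasure, Measure.coe_finsetSum, Finset.sum_apply, Measure.smul_apply,
      Measure.prod_prod, codeMeasure_trunc_preimage, smul_eq_mul]
    refine Finset.sum_congr rfl fun σ _ => ?_
    rw [Measure.map_apply (S.continuous_wordMap n σ).measurable hA]
  · intro σ τ hστ
    refine Set.disjoint_left.2 fun q h1 h2 => hστ ?_
    exact h1.1.symm.trans h2.1
  · exact fun σ => (S.measurable_trunc n (measurableSet_singleton σ)).prod
      ((S.continuous_wordMap n σ).measurable hA)

variable {S} {V : Set (EuclideanSpace ℝ (Fin N))}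

/-! ### Volume estimates -/

theorem RegularOpenSetCondition.wordMap_image_subset (hV : S.RegularOpenSetCondition V) :
    ∀ (n : ℕ) (σ : S.Word n), S.wordMap n σ '' V ⊆ V
  | 0, _ => by simp [wordMap]
  | n + 1, σ => by
    rw [wordMap, image_comp]
    exact (image_mono (hV.image_subset _ _)).trans (hV.wordMap_image_subset n _)

theorem RegularOpenSetCondition.disjoint_wordMap (hV : S.RegularOpenSetCondition V) :
    ∀ n : ℕ, Pairwise fun σ τ : S.Word n =>
      Disjoint (S.wordMap n σ '' V) (S.wordMap n τ '' V)
  | 0 => fun σ τ h => (h (Subsingleton.elim σ τ)).elim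
  | n + 1 => fun σ τ h => by
    simp only [wordMap, image_comp]
    by_cases hi : (fun i : Fin n => σ i.castSucc) = fun i : Fin n => τ i.castSucc
    · have hl : σ (Fin.last n) ≠ τ (Fin.last n) := fun hl => h <| funext fun i =>
        Fin.lastCases (motive := fun i => σ i = τ i) hl (fun j => congrFun hi j) i
      rw [hi]
      exact (disjoint_image_iff (S.injective_wordMap n _)).2 (hV.disjoint n hl)
    · exact (hV.disjoint_wordMap n hi).mono (image_mono (hV.image_subset _ _))
        (image_mono (hV.image_subset _ _))

/-- The `N`-dimensional Hausdorff measure serves as volume: its scaling under a similarity follows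
from distances alone, without any affine structure of the map. -/
theorem isAddHaarMeasure_hausdorffMeasure_natCast (N : ℕ) :
    (Measure.hausdorffMeasure N : Measure (EuclideanSpace ℝ (Fin N))).IsAddHaarMeasure := by
  simpa using isAddHaarMeasure_hausdorffMeasure (E := EuclideanSpace ℝ (Fin N))

theorem mul_hausdorffMeasure_le_image {f : EuclideanSpace ℝ (Fin N) → EuclideanSpace ℝ (Fin N)}
    {l : ℝ} (hl : 0 < l) (hf : ∀ x y, dist (f x) (f y) = l * dist x y)
    (A : Set (EuclideanSpace ℝ (Fin N))) :
    ENNReal.ofReal (l ^ N) * Measure.hausdorffMeasure N A ≤ Measure.hausdorffMeasure N (f '' A) := by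
  have hanti : AntilipschitzWith (l⁻¹).toNNReal f := AntilipschitzWith.of_le_mul_dist fun x y => by
    rw [hf, Real.coe_toNNReal _ (inv_nonneg.2 hl.le), inv_mul_cancel_left₀ hl.ne']
  have := hanti.le_hausdorffMeasure_image (d := N) (Nat.cast_nonneg N) A
  calc ENNReal.ofReal (l ^ N) * Measure.hausdorffMeasure N A
      ≤ ENNReal.ofReal (l ^ N) *
        (((l⁻¹).toNNReal : ℝ≥0∞) ^ (N : ℝ) * Measure.hausdorffMeasure N (f '' A)) := by gcongr
    _ = Measure.hausdorffMeasure N (f '' A) := by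
      rw [← mul_assoc, ENNReal.rpow_natCast, ENNReal.ofReal_pow hl.le, ← mul_pow]
      change (ENNReal.ofReal l * ENNReal.ofReal l⁻¹) ^ N * _ = _
      rw [← ENNReal.ofReal_mul hl.le, mul_inv_cancel₀ hl.ne', ENNReal.ofReal_one, one_pow, one_mul]

theorem sum_hausdorffMeasure_image_le {ι : Type*} (T : Finset ι)
    {f : ι → EuclideanSpace ℝ (Fin N) → EuclideanSpace ℝ (Fin N)} {l : ℝ} (hl : 0 < l)
    (hf : ∀ i x y, dist (f i x) (f i y) = l * dist x y) {A B : Set (EuclideanSpace ℝ (Fin N))}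
    (hA : MeasurableSet A) (hAB : ∀ i ∈ T, f i '' A ⊆ B)
    (hdisj : Pairwise fun i j => Disjoint (f i '' A) (f j '' A)) :
    T.card * (ENNReal.ofReal (l ^ N) * Measure.hausdorffMeasure N A) ≤
      Measure.hausdorffMeasure N B := by
  have hinj : ∀ i, Function.Injective (f i) := fun i x y hxy => by
    have := hf i x y
    rw [hxy, dist_self, zero_eq_mul] at this
    exact dist_eq_zero.1 (this.resolve_left hl.ne')
  have hcont : ∀ i, Continuous (f i) := fun i =>
    (LipschitzWith.of_dist_le_mul (K := ⟨l, hl.le⟩) fun x y => (hf i x y).le).continuous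
  have hmeas : ∀ i, MeasurableSet (f i '' A) := fun i =>
    hA.image_of_continuousOn_injOn (hcont i).continuousOn (hinj i).injOn
  calc T.card * (ENNReal.ofReal (l ^ N) * Measure.hausdorffMeasure N A)
      = ∑ i ∈ T, ENNReal.ofReal (l ^ N) * Measure.hausdorffMeasure N A := by simp
    _ ≤ ∑ i ∈ T, Measure.hausdorffMeasure N (f i '' A) :=
      Finset.sum_le_sum fun i _ => mul_hausdorffMeasure_le_image hl (hf i) A
    _ = Measure.hausdorffMeasure N (⋃ i ∈ T, f i '' A) :=
      (measure_biUnion_finset (fun i _ j _ hij => hdisj hij) fun i _ => hmeas i).symm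
    _ ≤ _ := measure_mono (iUnion₂_subset hAB)

theorem RegularOpenSetCondition.hausdorffMeasure_pos (hV : S.RegularOpenSetCondition V) :
    0 < (Measure.hausdorffMeasure N : Measure (EuclideanSpace ℝ (Fin N))) V := by
  have := isAddHaarMeasure_hausdorffMeasure_natCast N
  exact hV.isOpen.measure_pos _ hV.nonempty

theorem RegularOpenSetCondition.hausdorffMeasure_lt_top (hV : S.RegularOpenSetCondition V) :
    (Measure.hausdorffMeasure N : Measure (EuclideanSpace ℝ (Fin N))) V < ⊤ := by
  have := isAddHaarMeasure_hausdorffMeasure_natCast N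
  exact hV.isBounded.measure_lt_top

/-- The disjoint images of `V` fit inside `V`. With `two_le_p` this keeps the ratios uniformly away
from `1`, the source of all geometric decay below. -/
theorem RegularOpenSetCondition.card_mul_ratio_pow_le (hV : S.RegularOpenSetCondition V) (n : ℕ) :
    S.p n * S.ratio n ^ N ≤ 1 := by
  have h := sum_hausdorffMeasure_image_le Finset.univ (S.ratio_pos n) (S.dist_w n)
    hV.isOpen.measurableSet (fun j _ => hV.image_subset n j) (hV.disjoint n)
  rw [← mul_assoc, Finset.card_univ, Fintype.card_fin] at h
  rw [mul_comm] at h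
  have h1 := (ENNReal.mul_le_iff_le_inv hV.hausdorffMeasure_pos.ne'
    hV.hausdorffMeasure_lt_top.ne).1 h
  rw [ENNReal.inv_mul_cancel hV.hausdorffMeasure_pos.ne' hV.hausdorffMeasure_lt_top.ne] at h1
  have hr := S.ratio_pos n
  rw [← ENNReal.ofReal_natCast, ← ENNReal.ofReal_mul (by positivity), ENNReal.ofReal_le_one] at h1
  exact h1

theorem RegularOpenSetCondition.log_p_le (hV : S.RegularOpenSetCondition V) (n : ℕ) :
    Real.log (S.p n) ≤ N * Real.log (1 / S.ratio n) := by
  have hr := S.ratio_pos n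
  have hp : (0 : ℝ) < S.p n := Nat.cast_pos.2 (NeZero.pos _)
  have := Real.log_nonpos (by positivity) (hV.card_mul_ratio_pow_le n)
  rw [Real.log_mul hp.ne' (by positivity), Real.log_pow] at this
  rw [one_div, Real.log_inv]
  linarith

theorem RegularOpenSetCondition.dim_pos (hV : S.RegularOpenSetCondition V) : 0 < N := by
  rcases Nat.eq_zero_or_pos N with rfl | h
  · have h1 := hV.card_mul_ratio_pow_le 0
    have h2 : (2 : ℝ) ≤ S.p 0 := by exact_mod_cast S.two_le_p 0
    rw [pow_zero] at h1
    linarith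
  · exact h

theorem RegularOpenSetCondition.le_log_ratio (hV : S.RegularOpenSetCondition V) (n : ℕ) :
    Real.log 2 / N ≤ Real.log (1 / S.ratio n) := by
  have hN : (0 : ℝ) < N := Nat.cast_pos.2 hV.dim_pos
  rw [div_le_iff₀' hN]
  refine le_trans ?_ (hV.log_p_le n)
  exact Real.log_le_log two_pos (by exact_mod_cast S.two_le_p n)

theorem RegularOpenSetCondition.exists_ratio_le (hV : S.RegularOpenSetCondition V) :
    ∃ q : ℝ, 0 < q ∧ q < 1 ∧ ∀ n, S.ratio n ≤ q := by
  have hN : (0 : ℝ) < N := Nat.cast_pos.2 hV.dim_pos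
  refine ⟨Real.exp (-(Real.log 2 / N)), Real.exp_pos _, ?_, fun n => ?_⟩
  · rw [Real.exp_lt_one_iff, neg_lt_zero]
    exact div_pos (Real.log_pos one_lt_two) hN
  · rw [← Real.log_le_iff_le_exp (S.ratio_pos n)]
    have := hV.le_log_ratio n
    rw [one_div, Real.log_inv] at this
    linarith

theorem Lam_le_pow {q : ℝ} (hq : ∀ n, S.ratio n ≤ q) (n : ℕ) : S.Lam n ≤ q ^ n := by
  simpa [Lam] using Finset.prod_le_prod (s := Finset.range n) (fun i _ => (S.ratio_pos i).le)
    (fun i _ => hq i)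

theorem RegularOpenSetCondition.tendsto_Lam (hV : S.RegularOpenSetCondition V) :
    Tendsto S.Lam atTop (𝓝 0) := by
  obtain ⟨q, h0, h1, hq⟩ := hV.exists_ratio_le
  exact squeeze_zero (fun n => (S.Lam_pos n).le) (Lam_le_pow hq)
    (tendsto_pow_atTop_nhds_zero_of_lt_one h0.le h1)

theorem RegularOpenSetCondition.exists_dist_le (hV : S.RegularOpenSetCondition V) :
    ∃ R : ℝ, 0 < R ∧ ∀ x ∈ closure V, ∀ y ∈ closure V, dist x y < R := by
  -- The added `1` makes the bound strict, so that cells of generation `n` fit in open balls of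
  -- radius `R * Λ n`.
  refine ⟨Metric.diam (closure V) + 1, by linarith [Metric.diam_nonneg (s := closure V)],
    fun x hx y hy => ?_⟩
  linarith [Metric.dist_le_diam_of_mem hV.isBounded.closure hx hy]

/-- The number of cells of generation `n` that meet a ball of radius at most `Λ n` is bounded. -/
theorem RegularOpenSetCondition.exists_card_le (hV : S.RegularOpenSetCondition V) :
    ∃ C : ℕ, 0 < C ∧ ∀ (n : ℕ) (x : EuclideanSpace ℝ (Fin N)) (r : ℝ), r ≤ S.Lam n →
      ∀ T : Finset (S.Word n),
        (∀ σ ∈ T, (S.wordMap n σ '' closure V ∩ Metric.ball x r).Nonempty) → T.card ≤ C := by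
  have := isAddHaarMeasure_hausdorffMeasure_natCast N
  obtain ⟨R, hR, hdist⟩ := hV.exists_dist_le
  set H := (Measure.hausdorffMeasure N : Measure (EuclideanSpace ℝ (Fin N)))
  -- Cells meeting the ball lie in the concentric ball of radius `Λ n * (1 + R)`; after scaling,
  -- this ratio bounds their number in every generation.
  have hfin : H (Metric.ball 0 (1 + R)) / H V ≠ ⊤ :=
    ENNReal.div_ne_top measure_ball_lt_top.ne hV.hausdorffMeasure_pos.ne'
  obtain ⟨C, hC⟩ := ENNReal.exists_nat_gt hfin
  refine ⟨C, Nat.pos_of_ne_zero fun h => by simp [h] at hC, fun n x r hr T hT => ?_⟩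
  have hΛ := S.Lam_pos n
  have h := sum_hausdorffMeasure_image_le T hΛ (S.dist_wordMap n) hV.isOpen.measurableSet
    (B := Metric.ball x (S.Lam n * (1 + R))) (fun σ hσ => ?_) (hV.disjoint_wordMap n)
  · rw [Measure.addHaar_ball_mul_of_pos _ _ hΛ, finrank_euclideanSpace_fin, mul_left_comm,
      ENNReal.mul_le_mul_iff_right (by simpa using pow_pos hΛ N) ENNReal.ofReal_ne_top,
      ← ENNReal.le_div_iff_mul_le (Or.inl hV.hausdorffMeasure_pos.ne')
        (Or.inl hV.hausdorffMeasure_lt_top.ne)] at h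
    exact_mod_cast (h.trans hC.le)
  · obtain ⟨_, ⟨y, hy, rfl⟩, hyr⟩ := hT σ hσ
    rintro _ ⟨z, hz, rfl⟩
    have h1 := S.dist_wordMap n σ z y
    have h2 := hdist z (subset_closure hz) y hy
    have h3 := dist_triangle (S.wordMap n σ z) (S.wordMap n σ y) x
    rw [Metric.mem_ball] at hyr ⊢
    nlinarith

/-! ### The coding map and the limit measure -/

variable (S) in
/-- The point with a given infinite multi-index, as the limit of the images of a base point. -/
def code (v : EuclideanSpace ℝ (Fin N)) (ω : (i : ℕ) → Fin (S.p i)) : EuclideanSpace ℝ (Fin N) :=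
  haveI : Nonempty (EuclideanSpace ℝ (Fin N)) := ⟨v⟩
  limUnder atTop fun n => S.wordMap n (S.trunc n ω) v

/-- Consecutive images of `v` lie in a common cell, whose diameter decays geometrically. Another
point `y` stays at distance `Λ n * dist v y`, so the limit does not depend on it. -/
theorem RegularOpenSetCondition.tendsto_code (hV : S.RegularOpenSetCondition V)
    {v : EuclideanSpace ℝ (Fin N)} (hv : v ∈ V) (ω : (i : ℕ) → Fin (S.p i))
    (y : EuclideanSpace ℝ (Fin N)) :
    Tendsto (fun n => S.wordMap n (S.trunc n ω) y) atTop (𝓝 (S.code v ω)) := by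
  obtain ⟨q, h0, h1, hq⟩ := hV.exists_ratio_le
  obtain ⟨R, hR, hdist⟩ := hV.exists_dist_le
  have hc : CauchySeq fun n => S.wordMap n (S.trunc n ω) v := by
    refine cauchySeq_of_le_geometric q R h1 fun n => ?_
    rw [wordMap_trunc_succ, dist_wordMap, mul_comm]
    have h2 := hdist v (subset_closure hv) (S.w n (ω n) v)
      (subset_closure (hV.image_subset n _ (mem_image_of_mem _ hv)))
    exact mul_le_mul h2.le (Lam_le_pow hq n) (S.Lam_pos n).le hR.le
  have hlim := hc.tendsto_limUnder
  refine hlim.congr_dist ?_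
  simp only [dist_wordMap]
  simpa using hV.tendsto_Lam.mul_const (dist v y)

theorem RegularOpenSetCondition.code_mem (hV : S.RegularOpenSetCondition V)
    {v : EuclideanSpace ℝ (Fin N)} (hv : v ∈ V) (ω : (i : ℕ) → Fin (S.p i)) (n : ℕ) :
    S.code v ω ∈ S.wordMap n (S.trunc n ω) '' closure V := by
  have hanti : Antitone fun n => S.wordMap n (S.trunc n ω) '' V :=
    antitone_nat_of_succ_le fun n => by
      rintro _ ⟨z, hz, rfl⟩
      exact ⟨_, hV.image_subset n _ (mem_image_of_mem _ hz), rfl⟩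
  refine (hV.isBounded.isCompact_closure.image (S.continuous_wordMap n _)).isClosed.mem_of_tendsto
    (hV.tendsto_code hv ω v) ?_
  filter_upwards [eventually_ge_atTop n] with m hm
  exact image_mono subset_closure (hanti hm (mem_image_of_mem _ hv))

theorem RegularOpenSetCondition.measurable_code (hV : S.RegularOpenSetCondition V)
    {v : EuclideanSpace ℝ (Fin N)} (hv : v ∈ V) : Measurable (S.code v) :=
  measurable_of_tendsto_metrizable
    (fun n => (measurable_of_countable fun σ => S.wordMap n σ v).comp (S.measurable_trunc n))
    (tendsto_pi_nhds.2 fun ω => hV.tendsto_code hv ω v)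

variable (S) in
/-- The distribution of the point with a random infinite multi-index. -/
def limitMeasure (v : EuclideanSpace ℝ (Fin N)) : Measure (EuclideanSpace ℝ (Fin N)) :=
  S.codeMeasure.map (S.code v)

/-- Dominated convergence on the product of the code space with `μ₀`: the random points converge
pointwise to `S.code v ω`, whatever the starting point. -/
theorem RegularOpenSetCondition.isLimitMeasure (hV : S.RegularOpenSetCondition V)
    {v : EuclideanSpace ℝ (Fin N)} (hv : v ∈ V) : S.IsLimitMeasure (S.limitMeasure v) := by
  have hm := hV.measurable_code hv
  refine ⟨Measure.isProbabilityMeasure_map hm.aemeasurable, fun μ₀ _ f => ?_⟩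
  have hlim : ∫ x, f x ∂(S.limitMeasure v) = ∫ q, f (S.code v q.1) ∂(S.codeMeasure.prod μ₀) := by
    rw [limitMeasure, integral_map hm.aemeasurable f.continuous.aestronglyMeasurable,
      integral_fun_fst (fun ω => f (S.code v ω))]
    simp
  rw [hlim]
  have happ : ∀ n, ∫ x, f x ∂(S.approxMeasure μ₀ n) =
      ∫ q, f (S.wordMap n (S.trunc n q.1) q.2) ∂(S.codeMeasure.prod μ₀) := fun n => by
    obtain ⟨h1, h2⟩ := S.approxMeasure_eq_map μ₀ n
    rw [h1, integral_map h2.aemeasurable f.continuous.aestronglyMeasurable]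
  simp only [happ]
  refine tendsto_integral_of_dominated_convergence (fun _ => ‖f‖) (fun n => ?_)
    (integrable_const _) (fun n => ae_of_all _ fun q => f.norm_coe_le_norm _)
    (ae_of_all _ fun q => (f.continuous.tendsto _).comp (hV.tendsto_code hv q.1 q.2))
  exact (f.continuous.measurable.comp (S.approxMeasure_eq_map μ₀ n).2).aestronglyMeasurable

theorem IsLimitMeasure.eq {μ ν : Measure (EuclideanSpace ℝ (Fin N))} (hμ : S.IsLimitMeasure μ)
    (hν : S.IsLimitMeasure ν) : μ = ν := by
  have := hμ.1
  have := hν.1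
  exact ext_of_forall_integral_eq_of_IsFiniteMeasure fun f =>
    tendsto_nhds_unique (hμ.2 μ hμ.1 f) (hν.2 μ hμ.1 f)

theorem RegularOpenSetCondition.limitMeasure_fractal (hV : S.RegularOpenSetCondition V)
    {v : EuclideanSpace ℝ (Fin N)} (hv : v ∈ V) : S.limitMeasure v (S.fractal V) = 1 := by
  have hF : MeasurableSet (S.fractal V) :=
    (isClosed_iInter fun n => (isCompact_stage hV n).isClosed).measurableSet
  rw [limitMeasure, Measure.map_apply (hV.measurable_code hv) hF,
    show S.code v ⁻¹' S.fractal V = univ from eq_univ_of_forall fun ω =>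
      mem_iInter.2 fun n => mem_iUnion.2 ⟨_, hV.code_mem hv ω n⟩, measure_univ]

/-- A code landing in the ball has its prefix of length `n` among the boundedly many cells that meet
the ball. -/
theorem RegularOpenSetCondition.exists_measure_ball_le (hV : S.RegularOpenSetCondition V) :
    ∃ C : ℕ, 0 < C ∧ ∀ v ∈ V, ∀ (n : ℕ) (x : EuclideanSpace ℝ (Fin N)) (r : ℝ), r ≤ S.Lam n →
      S.limitMeasure v (Metric.ball x r) ≤ C * (S.P n : ℝ≥0∞)⁻¹ := by
  classical
  obtain ⟨C, hC0, hC⟩ := hV.exists_card_le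
  refine ⟨C, hC0, fun v hv n x r hr => ?_⟩
  set T : Finset (S.Word n) := Finset.univ.filter fun σ =>
    (S.wordMap n σ '' closure V ∩ Metric.ball x r).Nonempty with hT
  have hcard := hC n x r hr T fun σ hσ => (Finset.mem_filter.1 hσ).2
  rw [limitMeasure, Measure.map_apply (hV.measurable_code hv) measurableSet_ball]
  calc S.codeMeasure (S.code v ⁻¹' Metric.ball x r)
      ≤ S.codeMeasure (S.trunc n ⁻¹' (T : Set (S.Word n))) := measure_mono fun ω hω => by
        simp only [hT, mem_preimage, Finset.coe_filter, Finset.mem_univ, true_and, mem_ofPred_eq]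
        exact ⟨_, hV.code_mem hv ω n, hω⟩
    _ ≤ T.card * (S.P n : ℝ≥0∞)⁻¹ := S.codeMeasure_trunc_preimage_finset n T
    _ ≤ C * (S.P n : ℝ≥0∞)⁻¹ := by gcongr

/-- The point `x` lies in some cell of generation `n`, which the ball contains; every code with that
prefix lands there. -/
theorem RegularOpenSetCondition.exists_le_measure_ball (hV : S.RegularOpenSetCondition V) :
    ∃ R : ℝ, 0 < R ∧ ∀ v ∈ V, ∀ x ∈ S.fractal V, ∀ (n : ℕ) (r : ℝ), R * S.Lam n ≤ r →
      (S.P n : ℝ≥0∞)⁻¹ ≤ S.limitMeasure v (Metric.ball x r) := by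
  obtain ⟨R, hR, hdist⟩ := hV.exists_dist_le
  refine ⟨R, hR, fun v hv x hx n r hr => ?_⟩
  obtain ⟨σ, y, hy, rfl⟩ := mem_iUnion.1 (mem_iInter.1 hx n)
  rw [limitMeasure, Measure.map_apply (hV.measurable_code hv) measurableSet_ball,
    ← S.codeMeasure_trunc_preimage n σ]
  refine measure_mono fun ω hω => ?_
  obtain ⟨z, hz, hzω⟩ := hV.code_mem hv ω n
  rw [mem_preimage, mem_singleton_iff] at hω
  rw [mem_preimage, Metric.mem_ball, ← hzω, hω, dist_wordMap]
  nlinarith [hdist z hz y hy, S.Lam_pos n]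

end SimilaritySequence

/-! ### Dimensions in logarithmic coordinates -/

theorem map_exp_neg_atTop : map (fun t : ℝ => Real.exp (-t)) atTop = 𝓝[>] 0 := by
  rw [← Real.map_exp_atBot, ← map_neg_atTop, map_map]
  rfl

theorem liminf_nhdsGT_zero (f : ℝ → EReal) :
    liminf f (𝓝[>] 0) = liminf (fun t => f (Real.exp (-t))) atTop := by
  rw [← map_exp_neg_atTop]
  rfl

theorem limsup_nhdsGT_zero (f : ℝ → EReal) :
    limsup f (𝓝[>] 0) = limsup (fun t => f (Real.exp (-t))) atTop := by
  rw [← map_exp_neg_atTop]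
  rfl

section MetricMeasure

variable {X : Type*} [MetricSpace X] [MeasurableSpace X]

/-- Minus the logarithm of the measure of the ball of radius `exp (-t)`. -/
def negLogBall (μ : Measure X) (x : X) (t : ℝ) : ℝ :=
  -Real.log (μ.real (Metric.ball x (Real.exp (-t))))

variable {μ : Measure X} [IsFiniteMeasure μ] {x : X}

theorem monotone_negLogBall (hx : ∀ r : ℝ, 0 < r → μ (Metric.ball x r) ≠ 0) :
    Monotone (negLogBall μ x) := fun s t hst => by
  refine neg_le_neg (Real.log_le_log ?_ (measureReal_mono (Metric.ball_subset_ball ?_)))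
  · exact ENNReal.toReal_pos (hx _ (Real.exp_pos _)) (measure_ne_top _ _)
  · exact Real.exp_le_exp.2 (neg_le_neg hst)

theorem log_ball_div_log (hx : ∀ r : ℝ, 0 < r → μ (Metric.ball x r) ≠ 0) (t : ℝ) :
    ENNReal.log (μ (Metric.ball x (Real.exp (-t)))) / (Real.log (Real.exp (-t)) : EReal) =
      ((negLogBall μ x t / t : ℝ) : EReal) := by
  rw [ENNReal.log_pos_real (hx _ (Real.exp_pos _)) (measure_ne_top _ _), ← EReal.coe_div,
    Real.log_exp, negLogBall, neg_div, div_neg]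
  rfl

theorem log_ball_div_ball_div_log (hx : ∀ r : ℝ, 0 < r → μ (Metric.ball x r) ≠ 0) (s t : ℝ) :
    ENNReal.log (μ (Metric.ball x (Real.exp (-t))) /
        μ (Metric.ball x (Real.exp (-s) * Real.exp (-t)))) /
        (Real.log (1 / Real.exp (-s)) : EReal) =
      (((negLogBall μ x (t + s) - negLogBall μ x t) / s : ℝ) : EReal) := by
  have h1 := hx _ (Real.exp_pos (-t))
  have h2 := hx _ (Real.exp_pos (-s + -t))
  have h3 := measure_ne_top μ (Metric.ball x (Real.exp (-t)))
  have h4 := measure_ne_top μ (Metric.ball x (Real.exp (-s + -t)))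
  rw [← Real.exp_add, ENNReal.log_pos_real (ENNReal.div_ne_zero.2 ⟨h1, h4⟩)
    (ENNReal.div_ne_top h3 h2), ← EReal.coe_div, ENNReal.toReal_div,
    Real.log_div (ENNReal.toReal_ne_zero.2 ⟨h1, h3⟩) (ENNReal.toReal_ne_zero.2 ⟨h2, h4⟩),
    one_div, Real.log_inv, Real.log_exp, neg_neg, negLogBall, negLogBall, neg_add_rev t s]
  congr 2
  simp only [Measure.real]
  ring

theorem lowerLocalDim_eq (hx : ∀ r : ℝ, 0 < r → μ (Metric.ball x r) ≠ 0) :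
    lowerLocalDim μ x = liminf (fun t : ℝ => ((negLogBall μ x t / t : ℝ) : EReal)) atTop := by
  simp only [lowerLocalDim, liminf_nhdsGT_zero, log_ball_div_log hx]

theorem upperLocalDim_eq (hx : ∀ r : ℝ, 0 < r → μ (Metric.ball x r) ≠ 0) :
    upperLocalDim μ x = limsup (fun t : ℝ => ((negLogBall μ x t / t : ℝ) : EReal)) atTop := by
  simp only [upperLocalDim, limsup_nhdsGT_zero, log_ball_div_log hx]

theorem lowerTangentialDim_eq (hx : ∀ r : ℝ, 0 < r → μ (Metric.ball x r) ≠ 0) :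
    lowerTangentialDim μ x = liminf (fun s : ℝ => liminf (fun t : ℝ =>
      (((negLogBall μ x (t + s) - negLogBall μ x t) / s : ℝ) : EReal)) atTop) atTop := by
  simp only [lowerTangentialDim, liminf_nhdsGT_zero, log_ball_div_ball_div_log hx]

theorem upperTangentialDim_eq (hx : ∀ r : ℝ, 0 < r → μ (Metric.ball x r) ≠ 0) :
    upperTangentialDim μ x = limsup (fun s : ℝ => limsup (fun t : ℝ =>
      (((negLogBall μ x (t + s) - negLogBall μ x t) / s : ℝ) : EReal)) atTop) atTop := by
  simp only [upperTangentialDim, limsup_nhdsGT_zero, log_ball_div_ball_div_log hx]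

end MetricMeasure

/-- The mass distribution principle. -/
theorem smul_le_hausdorffMeasure_of_ball_le {X : Type*} [MetricSpace X]
    [MeasurableSpace X] [BorelSpace X] (μ : Measure X) {d κ r₀ : ℝ}
    (hd : 0 ≤ d) (hr₀ : 0 < r₀)
    (h : ∀ x r, 0 < r → r ≤ r₀ →
      ENNReal.ofReal κ * μ (Metric.ball x r) ≤ ENNReal.ofReal (r ^ d)) :
    ENNReal.ofReal κ • μ ≤ Measure.hausdorffMeasure d := by
  -- A set of diameter `ρ` lies in every ball about one of its points of radius `r > ρ`; halving
  -- `r₀` leaves room for such `r ≤ r₀`, which then decrease to `ρ`.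
  refine Measure.le_hausdorffMeasure d _ (ENNReal.ofReal (r₀ / 2)) (by simpa using hr₀)
    fun s hs => ?_
  rw [Measure.smul_apply, smul_eq_mul]
  rcases s.eq_empty_or_nonempty with rfl | ⟨x, hx⟩
  · simp
  have hfin : Metric.ediam s ≠ ⊤ := (hs.trans_lt ENNReal.ofReal_lt_top).ne
  set ρ := (Metric.ediam s).toReal with hρ
  have hρ0 : 0 ≤ ρ := ENNReal.toReal_nonneg
  have hρ1 : ρ ≤ r₀ / 2 := ENNReal.toReal_le_of_le_ofReal (by linarith) hs
  have hlim : Tendsto (fun r : ℝ => ENNReal.ofReal (r ^ d)) (𝓝[>] ρ) (𝓝 (Metric.ediam s ^ d)) := by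
    rw [← ENNReal.ofReal_toReal hfin, ENNReal.ofReal_rpow_of_nonneg hρ0 hd]
    exact ((ENNReal.continuous_ofReal.comp
      (Real.continuous_rpow_const hd)).tendsto ρ).mono_left nhdsWithin_le_nhds
  refine ge_of_tendsto hlim ?_
  filter_upwards [self_mem_nhdsWithin, Ioc_mem_nhdsGT (show ρ < r₀ by linarith)] with r hr hr'
  refine le_trans ?_ (h x r (hρ0.trans_lt hr) hr'.2)
  gcongr
  intro y hy
  rw [Metric.mem_ball, dist_edist]
  exact (ENNReal.toReal_mono hfin (Metric.edist_le_ediam_of_mem hy hx)).trans_lt hr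

/-! ### Tracking of the ball masses by `log P n` -/

namespace SimilaritySequence

variable {N : ℕ} {S : SimilaritySequence N} {V : Set (EuclideanSpace ℝ (Fin N))}

theorem log_one_div_Lam_succ (n : ℕ) :
    Real.log (1 / S.Lam (n + 1)) = Real.log (1 / S.Lam n) + Real.log (1 / S.ratio n) := by
  rw [Lam_succ, ← Real.log_mul (one_div_pos.2 (S.Lam_pos n)).ne'
    (one_div_pos.2 (S.ratio_pos n)).ne', one_div_mul_one_div]

theorem log_P_succ (n : ℕ) :
    Real.log (S.P (n + 1)) = Real.log (S.P n) + Real.log (S.p n) := by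
  rw [P_succ, Nat.cast_mul, Real.log_mul (Nat.cast_ne_zero.2 (S.P_pos n).ne')
    (Nat.cast_ne_zero.2 (NeZero.ne _))]

theorem P_add_le {M : ℕ} (hM : ∀ n, S.p n ≤ M) (n k : ℕ) : S.P (n + k) ≤ S.P n * M ^ k := by
  induction k with
  | zero => simp
  | succ k ih =>
    rw [← add_assoc, P_succ, pow_succ, ← mul_assoc]
    exact Nat.mul_le_mul ih (hM _)

theorem Lam_add_le {q : ℝ} (hq : ∀ n, S.ratio n ≤ q) (n k : ℕ) :
    S.Lam (n + k) ≤ S.Lam n * q ^ k := by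
  have hq0 : 0 ≤ q := (S.ratio_pos 0).le.trans (hq 0)
  induction k with
  | zero => simp
  | succ k ih =>
    rw [← add_assoc, Lam_succ, pow_succ, ← mul_assoc]
    exact mul_le_mul ih (hq _) (S.ratio_pos _).le (mul_nonneg (S.Lam_pos n).le (pow_nonneg hq0 k))

theorem RegularOpenSetCondition.measure_ball_ne_zero (hV : S.RegularOpenSetCondition V)
    {v x : EuclideanSpace ℝ (Fin N)} (hv : v ∈ V) (hx : x ∈ S.fractal V) {r : ℝ} (hr : 0 < r) :
    S.limitMeasure v (Metric.ball x r) ≠ 0 := by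
  obtain ⟨R, -, hR⟩ := hV.exists_le_measure_ball
  have h0 : Tendsto (fun n => R * S.Lam n) atTop (𝓝 0) := by
    simpa using hV.tendsto_Lam.const_mul R
  obtain ⟨n, hn⟩ := (h0.eventually_le_const hr).exists
  exact ((ENNReal.inv_pos.2 (ENNReal.natCast_ne_top _)).trans_le (hR v hv x hx n r hn)).ne'

theorem RegularOpenSetCondition.exists_tracksAlong (hV : S.RegularOpenSetCondition V)
    (hp : BddAbove (Set.range S.p)) {v x : EuclideanSpace ℝ (Fin N)} (hv : v ∈ V)
    (hx : x ∈ S.fractal V) :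
    ∃ A c K : ℝ, TracksAlong (fun n => Real.log (S.P n)) (fun n => Real.log (1 / S.Lam n)) A c
      (negLogBall (S.limitMeasure v) x) K := by
  obtain ⟨M, hM⟩ := hp
  replace hM : ∀ n, S.p n ≤ M := fun n => hM (mem_range_self n)
  have hM1 : 1 ≤ M := one_le_two.trans ((S.two_le_p 0).trans (hM 0))
  obtain ⟨q, hq0, hq1, hq⟩ := hV.exists_ratio_le
  obtain ⟨C, hC0, hC⟩ := hV.exists_measure_ball_le
  obtain ⟨R, hR0, hR⟩ := hV.exists_le_measure_ball
  -- After `j` further generations the factor `R` is absorbed: `R * Λ (n + 1 + j) ≤ Λ (n + 1)`.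
  obtain ⟨j, hj⟩ : ∃ j : ℕ, R * q ^ j ≤ 1 := by
    have : Tendsto (fun j : ℕ => R * q ^ j) atTop (𝓝 0) := by
      simpa using (tendsto_pow_atTop_nhds_zero_of_lt_one hq0.le hq1).const_mul R
    exact (this.eventually_le_const one_pos).exists
  have hprob := (hV.isLimitMeasure hv).1
  have hball : ∀ r : ℝ, 0 < r → S.limitMeasure v (Metric.ball x r) ≠ 0 :=
    fun r hr => hV.measure_ball_ne_zero hv hx hr
  have hlogC : 0 ≤ Real.log C := Real.log_natCast_nonneg C
  have hlogM : 0 ≤ Real.log M := Real.log_natCast_nonneg M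
  have hPpos : ∀ n, (0 : ℝ) < S.P n := fun n => Nat.cast_pos.2 (S.P_pos n)
  -- In the last constant, `log C` comes from the upper bound on the mass, and `(1 + j) * log M`
  -- from comparing `P (n + 1 + j)` with `P n` in the lower one.
  refine ⟨Real.log M, Real.log 2 / N, Real.log C + (1 + j) * Real.log M, ?_, ?_, ?_, ?_, ?_, ?_,
    monotone_negLogBall hball, ?_⟩
  · exact div_pos (Real.log_pos one_lt_two) (Nat.cast_pos.2 hV.dim_pos)
  · simp [Lam]
  · intro n
    rw [log_one_div_Lam_succ]
    linarith [hV.le_log_ratio n]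
  · simp [P]
  · refine monotone_nat_of_le_succ fun n => ?_
    rw [log_P_succ]
    linarith [Real.log_natCast_nonneg (S.p n)]
  · intro n
    rw [log_P_succ]
    have := Real.log_le_log (Nat.cast_pos.2 (NeZero.pos (S.p n))) (Nat.cast_le (α := ℝ).2 (hM n))
    linarith
  · intro n t h1 h2
    rw [one_div, Real.log_inv] at h1 h2
    have h1' : Real.exp (-t) ≤ S.Lam n := by
      rw [← Real.le_log_iff_exp_le (S.Lam_pos n)]
      linarith
    have h2' : S.Lam (n + 1) ≤ Real.exp (-t) := by
      rw [← Real.log_le_iff_le_exp (S.Lam_pos _)]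
      linarith
    have hm : 0 < (S.limitMeasure v).real (Metric.ball x (Real.exp (-t))) :=
      ENNReal.toReal_pos (hball _ (Real.exp_pos _)) (measure_ne_top _ _)
    have hup : (S.limitMeasure v).real (Metric.ball x (Real.exp (-t))) ≤ C * (S.P n : ℝ)⁻¹ := by
      have := ENNReal.toReal_mono (ENNReal.mul_ne_top (ENNReal.natCast_ne_top C)
        (ENNReal.inv_ne_top.2 (Nat.cast_ne_zero.2 (S.P_pos n).ne'))) (hC v hv n x _ h1')
      simpa [Measure.real] using this
    have hlow : (S.P (n + (1 + j)) : ℝ)⁻¹ ≤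
        (S.limitMeasure v).real (Metric.ball x (Real.exp (-t))) := by
      have := ENNReal.toReal_mono (measure_ne_top _ _)
        (hR v hv x hx (n + (1 + j)) (Real.exp (-t)) ?_)
      · simpa [Measure.real] using this
      · have := Lam_add_le hq (n + 1) j
        rw [← add_assoc]
        nlinarith [S.Lam_pos (n + 1)]
    have e1 := Real.log_le_log hm hup
    have e2 := Real.log_le_log (inv_pos.2 (hPpos _)) hlow
    rw [Real.log_mul (Nat.cast_ne_zero.2 hC0.ne') (inv_pos.2 (hPpos n)).ne', Real.log_inv] at e1
    rw [Real.log_inv] at e2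
    have e3 := Real.log_le_log (hPpos _) (Nat.cast_le (α := ℝ).2 (P_add_le hM n (1 + j)))
    rw [Nat.cast_mul, Nat.cast_pow, Real.log_mul (hPpos n).ne'
      (pow_ne_zero _ (Nat.cast_ne_zero.2 (by omega))), Real.log_pow] at e3
    push_cast at e3
    have e4 : 0 ≤ (1 + (j : ℝ)) * Real.log M := by positivity
    rw [abs_le, negLogBall]
    constructor <;> linarith

/-! ### Hausdorff measures of the fractal -/

theorem log_P_sub_eq (d : ℝ) (n : ℕ) : Real.exp (Real.log (S.P n) - d * Real.log (1 / S.Lam n)) =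
    S.P n * S.Lam n ^ d := by
  rw [one_div, Real.log_inv, mul_neg, sub_neg_eq_add, Real.exp_add,
    Real.exp_log (Nat.cast_pos.2 (S.P_pos n)), Real.rpow_def_of_pos (S.Lam_pos n), mul_comm d]

/-- Covering by the cells of generation `n` costs at most `R ^ d * (P n * Λ n ^ d)`. Only a liminf
of the costs counts, so infinitely many good `n` suffice. -/
theorem RegularOpenSetCondition.exists_hausdorffMeasure_le (hV : S.RegularOpenSetCondition V) :
    ∃ R : ℝ, 0 < R ∧ ∀ d : ℝ, 0 ≤ d → ∀ b : ℝ,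
      (∃ᶠ n in atTop, Real.log (S.P n) - d * Real.log (1 / S.Lam n) ≤ b) →
      Measure.hausdorffMeasure d (S.fractal V) ≤ ENNReal.ofReal (R ^ d * Real.exp b) := by
  obtain ⟨R, hR, hdist⟩ := hV.exists_dist_le
  refine ⟨R, hR, fun d hd b hb => ?_⟩
  have hdiam : ∀ n (σ : S.Word n), Metric.ediam (S.wordMap n σ '' closure V) ≤
      ENNReal.ofReal (R * S.Lam n) := fun n σ => by
    refine Metric.ediam_le ?_
    rintro _ ⟨y, hy, rfl⟩ _ ⟨z, hz, rfl⟩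
    rw [edist_dist, dist_wordMap]
    refine ENNReal.ofReal_le_ofReal ?_
    nlinarith [hdist y hy z hz, S.Lam_pos n]
  have hr : Tendsto (fun n => ENNReal.ofReal (R * S.Lam n)) atTop (𝓝 0) := by
    have := ENNReal.tendsto_ofReal (hV.tendsto_Lam.const_mul R)
    simpa using this
  refine (Measure.hausdorffMeasure_le_liminf_sum d (S.fractal V) _ hr
    (fun n (σ : S.Word n) => S.wordMap n σ '' closure V) (Eventually.of_forall hdiam)
    (Eventually.of_forall fun n => iInter_subset _ n)).trans ?_
  refine liminf_le_of_frequently_le' (hb.mono fun n hn => ?_)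
  have hΛ := S.Lam_pos n
  calc ∑ σ : S.Word n, Metric.ediam (S.wordMap n σ '' closure V) ^ d
      ≤ ∑ _σ : S.Word n, ENNReal.ofReal (R * S.Lam n) ^ d :=
        Finset.sum_le_sum fun σ _ => ENNReal.rpow_le_rpow (hdiam n σ) hd
    _ = ENNReal.ofReal (R ^ d * (S.P n * S.Lam n ^ d)) := by
      rw [Finset.sum_const, Finset.card_univ, card_word, nsmul_eq_mul,
        ENNReal.ofReal_rpow_of_pos (by positivity), ← ENNReal.ofReal_natCast,
        ← ENNReal.ofReal_mul (by positivity), Real.mul_rpow hR.le hΛ.le]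
      congr 1
      ring
    _ ≤ _ := by
      refine ENNReal.ofReal_le_ofReal (mul_le_mul_of_nonneg_left ?_ (by positivity))
      rw [← log_P_sub_eq]
      exact Real.exp_le_exp.2 hn

theorem RegularOpenSetCondition.exists_Lam_lt (hV : S.RegularOpenSetCondition V) {n₀ : ℕ} {r : ℝ}
    (hr : 0 < r) (hr' : r ≤ S.Lam n₀) : ∃ n ≥ n₀, S.Lam (n + 1) < r ∧ r ≤ S.Lam n := by
  classical
  have hex : ∃ k, S.Lam (n₀ + k) < r := by
    obtain ⟨m, hm, hm'⟩ := ((hV.tendsto_Lam.eventually_lt_const hr).and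
      (eventually_ge_atTop n₀)).exists
    exact ⟨m - n₀, by rwa [Nat.add_sub_cancel' hm']⟩
  have h0 : Nat.find hex ≠ 0 := fun h0 => by
    have := Nat.find_spec hex
    rw [h0, add_zero] at this
    linarith
  obtain ⟨k, hk⟩ := Nat.exists_eq_succ_of_ne_zero h0
  refine ⟨n₀ + k, Nat.le_add_right _ _, ?_, not_lt.1 (Nat.find_min hex (by omega))⟩
  have := Nat.find_spec hex
  rwa [hk] at this

/-- For `Λ (n + 1) < r ≤ Λ n`, a ball of radius `r` has mass at most `C / P n ≤ C * M / P (n + 1)`,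
and this is at most `C * M * exp (-b) * r ^ d`. The mass distribution principle then applies with `κ
= 1 / (C * M)`, independent of `b`. -/
theorem RegularOpenSetCondition.exists_le_hausdorffMeasure (hV : S.RegularOpenSetCondition V)
    (hp : BddAbove (Set.range S.p)) :
    ∃ κ : ℝ, 0 < κ ∧ ∀ d : ℝ, 0 ≤ d → ∀ b : ℝ,
      (∀ᶠ n in atTop, b ≤ Real.log (S.P n) - d * Real.log (1 / S.Lam n)) →
      ENNReal.ofReal (κ * Real.exp b) ≤ Measure.hausdorffMeasure d (S.fractal V) := by
  obtain ⟨M, hM⟩ := hp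
  replace hM : ∀ n, S.p n ≤ M := fun n => hM (mem_range_self n)
  have hM0 : (0 : ℝ) < M := Nat.cast_pos.2 ((NeZero.pos (S.p 0)).trans_le (hM 0))
  obtain ⟨C, hC0, hC⟩ := hV.exists_measure_ball_le
  have hC0' : (0 : ℝ) < C := Nat.cast_pos.2 hC0
  obtain ⟨v, hv⟩ := hV.nonempty
  refine ⟨(C * M : ℝ)⁻¹, by positivity, fun d hd b hb => ?_⟩
  obtain ⟨n₀, hn₀⟩ := eventually_atTop.1 hb
  have key := smul_le_hausdorffMeasure_of_ball_le (S.limitMeasure v) (d := d)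
    (κ := (C * M : ℝ)⁻¹ * Real.exp b) hd (S.Lam_pos n₀) fun x r hr hr' => ?_
  · have := key (S.fractal V)
    rwa [Measure.smul_apply, hV.limitMeasure_fractal hv, smul_eq_mul, mul_one] at this
  · obtain ⟨n, hn, h1, h2⟩ := hV.exists_Lam_lt hr hr'
    have hP : (0 : ℝ) < S.P n := Nat.cast_pos.2 (S.P_pos n)
    have hΛ := S.Lam_pos (n + 1)
    calc ENNReal.ofReal ((C * M : ℝ)⁻¹ * Real.exp b) * S.limitMeasure v (Metric.ball x r)
        ≤ ENNReal.ofReal ((C * M : ℝ)⁻¹ * Real.exp b) * (C * (S.P n : ℝ≥0∞)⁻¹) := by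
          gcongr
          exact hC v hv n x r h2
      _ = ENNReal.ofReal (Real.exp b / (S.P n * M)) := by
          rw [← ENNReal.ofReal_natCast C, ← ENNReal.ofReal_natCast (S.P n),
            ← ENNReal.ofReal_inv_of_pos hP, ← ENNReal.ofReal_mul (by positivity),
            ← ENNReal.ofReal_mul (by positivity)]
          congr 1
          field_simp
      _ ≤ ENNReal.ofReal (r ^ d) := by
          refine ENNReal.ofReal_le_ofReal ?_
          have h3 := Real.exp_le_exp.2 (hn₀ (n + 1) (by omega))
          rw [log_P_sub_eq] at h3
          have h4 : (S.P (n + 1) : ℝ) ≤ S.P n * M := by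
            exact_mod_cast (by simpa using P_add_le hM n 1)
          rw [div_le_iff₀ (by positivity), mul_comm]
          exact h3.trans (mul_le_mul h4 (Real.rpow_le_rpow hΛ.le h1.le hd) (by positivity)
            (by positivity))

theorem RegularOpenSetCondition.eventually_log_Lam_pos (hV : S.RegularOpenSetCondition V) :
    ∀ᶠ n in atTop, 0 < Real.log (1 / S.Lam n) := by
  filter_upwards [hV.tendsto_Lam.eventually_lt_const one_pos] with n hn
  exact Real.log_pos (one_lt_one_div (S.Lam_pos n) hn)

/-- Both Hausdorff estimates are used with `b = 0`: an exponent `c` above the liminf makes `log P n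
- c * log (1 / Λ n)` negative infinitely often, while a nonnegative one below it makes this
eventually positive. -/
theorem RegularOpenSetCondition.dimH_fractal (hV : S.RegularOpenSetCondition V)
    (hp : BddAbove (Set.range S.p)) : (dimH (S.fractal V) : EReal) =
      liminf (fun n : ℕ => ((Real.log (S.P n) / Real.log (1 / S.Lam n) : ℝ) : EReal)) atTop := by
  have hpos := hV.eventually_log_Lam_pos
  have hcoe : ∀ c : NNReal, (((c : ℝ≥0∞) : EReal)) = ((c : ℝ) : EReal) := fun c => rfl
  apply le_antisymm
  · obtain ⟨R, hR, hle⟩ := hV.exists_hausdorffMeasure_le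
    refine EReal.le_of_forall_le_real_add fun c hc ε hε => ?_
    have hfreq := (frequently_lt_of_liminf_lt (by isBoundedDefault) hc).and_eventually hpos
    have hc0 : 0 ≤ c := by
      obtain ⟨n, hn, hL⟩ := hfreq.exists
      exact (div_nonneg (Real.log_natCast_nonneg _) hL.le).trans (EReal.coe_lt_coe_iff.1 hn).le
    have := hle c hc0 0 (hfreq.mono fun n hn => by
      have := (div_lt_iff₀ hn.2).1 (EReal.coe_lt_coe_iff.1 hn.1)
      linarith)
    lift c to NNReal using hc0
    have h2 := dimH_le_of_hausdorffMeasure_ne_top (this.trans_lt ENNReal.ofReal_lt_top).ne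
    refine (EReal.coe_ennreal_le_coe_ennreal_iff.2 h2).trans ?_
    rw [hcoe, EReal.coe_le_coe_iff]
    linarith
  · obtain ⟨κ, hκ, hle⟩ := hV.exists_le_hausdorffMeasure hp
    refine EReal.le_of_forall_real_sub_le fun c hc ε hε => ?_
    rcases lt_or_ge c 0 with hc0 | hc0
    · refine le_trans ?_ (EReal.coe_ennreal_nonneg _)
      exact_mod_cast (by linarith : c - ε ≤ 0)
    have := hle c hc0 0 (((eventually_lt_of_lt_liminf hc).and hpos).mono fun n hn => by
      have := (lt_div_iff₀ hn.2).1 (EReal.coe_lt_coe_iff.1 hn.1)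
      linarith)
    lift c to NNReal using hc0
    have h2 := le_dimH_of_hausdorffMeasure_ne_zero
      ((ENNReal.ofReal_pos.2 (by positivity)).trans_le this).ne'
    refine le_trans ?_ (EReal.coe_ennreal_le_coe_ennreal_iff.2 h2)
    rw [hcoe, EReal.coe_le_coe_iff]
    linarith

/-- Up to constants independent of `b`, the measure is at least `exp b` for `b` below the liminf and
at most `exp b` for `b` above it. Letting `b` tend to `-∞` or `+∞` rules out an infinite liminf. -/
theorem RegularOpenSetCondition.hausdorffMeasure_pos_lt_top_iff
    (hV : S.RegularOpenSetCondition V) (hp : BddAbove (Set.range S.p)) {d : ℝ} (hd : 0 ≤ d) :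
    (0 < Measure.hausdorffMeasure d (S.fractal V) ∧
        Measure.hausdorffMeasure d (S.fractal V) < ⊤) ↔
      ∃ c : ℝ, liminf (fun n : ℕ =>
        ((Real.log (S.P n) - d * Real.log (1 / S.Lam n) : ℝ) : EReal)) atTop = (c : EReal) := by
  obtain ⟨R, hR, hle⟩ := hV.exists_hausdorffMeasure_le
  obtain ⟨κ, hκ, hge⟩ := hV.exists_le_hausdorffMeasure hp
  have hfreq : ∀ b : ℝ, liminf (fun n : ℕ =>
      ((Real.log (S.P n) - d * Real.log (1 / S.Lam n) : ℝ) : EReal)) atTop < (b : EReal) →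
      Measure.hausdorffMeasure d (S.fractal V) ≤ ENNReal.ofReal (R ^ d * Real.exp b) :=
    fun b hb => hle d hd b ((frequently_lt_of_liminf_lt (by isBoundedDefault) hb).mono
      fun n hn => (EReal.coe_lt_coe_iff.1 hn).le)
  have hev : ∀ b : ℝ, (b : EReal) < liminf (fun n : ℕ =>
      ((Real.log (S.P n) - d * Real.log (1 / S.Lam n) : ℝ) : EReal)) atTop →
      ENNReal.ofReal (κ * Real.exp b) ≤ Measure.hausdorffMeasure d (S.fractal V) :=
    fun b hb => hge d hd b ((eventually_lt_of_lt_liminf hb).mono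
      fun n hn => (EReal.coe_lt_coe_iff.1 hn).le)
  constructor
  · rintro ⟨hpos, hfin⟩
    generalize liminf (fun n : ℕ =>
      ((Real.log (S.P n) - d * Real.log (1 / S.Lam n) : ℝ) : EReal)) atTop = y at hfreq hev
    induction y with
    | coe c => exact ⟨c, rfl⟩
    | bot =>
      have hlim : Tendsto (fun b : ℝ => ENNReal.ofReal (R ^ d * Real.exp b)) atBot (𝓝 0) := by
        simpa using ENNReal.tendsto_ofReal (Real.tendsto_exp_atBot.const_mul (R ^ d))
      exact (hpos.not_ge (ge_of_tendsto' hlim fun b => hfreq b (EReal.bot_lt_coe b))).elim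
    | top =>
      have hlim : Tendsto (fun b : ℝ => ENNReal.ofReal (κ * Real.exp b)) atTop (𝓝 ⊤) :=
        ENNReal.tendsto_ofReal_atTop.comp (Real.tendsto_exp_atTop.const_mul_atTop hκ)
      exact (hfin.not_ge (le_of_tendsto' hlim fun b => hev b (EReal.coe_lt_top b))).elim
  · rintro ⟨c, hc⟩
    rw [hc] at hfreq hev
    constructor
    · exact (ENNReal.ofReal_pos.2 (by positivity)).trans_le
        (hev (c - 1) (EReal.coe_lt_coe_iff.2 (by linarith)))
    · exact (hfreq (c + 1) (EReal.coe_lt_coe_iff.2 (by linarith))).trans_lt ENNReal.ofReal_lt_top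

end SimilaritySequence

end

theorem mainTheorem1 (N : ℕ) (S : SimilaritySequence N) (V : Set (EuclideanSpace ℝ (Fin N)))
    (hV : S.RegularOpenSetCondition V) (hp : BddAbove (Set.range S.p)) :
    -- the canonical limit measure exists and is unique
    (∃! μ : Measure (EuclideanSpace ℝ (Fin N)), S.IsLimitMeasure μ) ∧
    -- its tangential and local dimensions at every point of the fractal
    (∀ μ : Measure (EuclideanSpace ℝ (Fin N)), S.IsLimitMeasure μ → ∀ x ∈ S.fractal V,
      lowerTangentialDim μ x =
        liminf (fun q : ℕ × ℕ =>
          (((Real.log (S.P (q.1 + q.2)) - Real.log (S.P q.1)) /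
            (Real.log (1 / S.Lam (q.1 + q.2)) - Real.log (1 / S.Lam q.1)) : ℝ) : EReal))
          (atTop ×ˢ atTop) ∧
      upperTangentialDim μ x =
        limsup (fun q : ℕ × ℕ =>
          (((Real.log (S.P (q.1 + q.2)) - Real.log (S.P q.1)) /
            (Real.log (1 / S.Lam (q.1 + q.2)) - Real.log (1 / S.Lam q.1)) : ℝ) : EReal))
          (atTop ×ˢ atTop) ∧
      lowerLocalDim μ x = (dimH (S.fractal V) : EReal) ∧
      lowerLocalDim μ x =
        liminf (fun n : ℕ => ((Real.log (S.P n) / Real.log (1 / S.Lam n) : ℝ) : EReal)) atTop ∧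
      upperLocalDim μ x =
        limsup (fun n : ℕ => ((Real.log (S.P n) / Real.log (1 / S.Lam n) : ℝ) : EReal)) atTop) ∧
    -- the Hausdorff dimension of the fractal
    (dimH (S.fractal V) : EReal) =
      liminf (fun n : ℕ => ((Real.log (S.P n) / Real.log (1 / S.Lam n) : ℝ) : EReal)) atTop ∧
    -- nontriviality of the Hausdorff measure in the Hausdorff dimension of the fractal
    ((0 < Measure.hausdorffMeasure (dimH (S.fractal V)).toReal (S.fractal V) ∧
        Measure.hausdorffMeasure (dimH (S.fractal V)).toReal (S.fractal V) < ⊤) ↔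
      ∃ c : ℝ, liminf (fun n : ℕ =>
        ((Real.log (S.P n) - (dimH (S.fractal V)).toReal * Real.log (1 / S.Lam n) : ℝ) : EReal))
        atTop = (c : EReal)) := by
  refine ⟨?_, ?_, hV.dimH_fractal hp, hV.hausdorffMeasure_pos_lt_top_iff hp ENNReal.toReal_nonneg⟩
  · obtain ⟨v, hv⟩ := hV.nonempty
    exact ⟨S.limitMeasure v, hV.isLimitMeasure hv, fun μ hμ => hμ.eq (hV.isLimitMeasure hv)⟩
  · intro μ hμ x hx
    obtain ⟨v, hv⟩ := hV.nonempty
    -- Uniqueness replaces the given measure by the law of the random point, for which the ball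
    -- estimates are available.
    obtain rfl := hμ.eq (hV.isLimitMeasure hv)
    have := hμ.1
    have hball := fun (r : ℝ) (hr : 0 < r) => hV.measure_ball_ne_zero hv hx hr
    obtain ⟨A, c, K, h⟩ := hV.exists_tracksAlong hp hv hx
    have hlow := (lowerLocalDim_eq hball).trans h.liminf_div
    exact ⟨(lowerTangentialDim_eq hball).trans h.liminf_window,
      (upperTangentialDim_eq hball).trans h.limsup_window,
      hlow.trans (hV.dimH_fractal hp).symm, hlow,
      (upperLocalDim_eq hball).trans h.limsup_div⟩
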